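/- All Hilbert spaces are finite-dimensional and complex. A sub-normalized state on $\mathcal H$ is a positive semidefinite operator $\rho$ with $0<\operatorname{tr}\rho\le 1$; it is normalized if $\operatorname{tr}\rho=1$. Write $\mathcal S_{\le}(\mathcal H)$ and $\mathcal S_{=}(\mathcal H)$ for the sets of sub-normalized and of normalized states. The fidelity is $F(\rho,\tau)=\|\sqrt\rho\sqrt\tau\|_1=\operatorname{tr}\sqrt{X^\dagger X}$ with $X=\sqrt\rho\sqrt\tau$. For $\rho,\tau\in\mathcal S_{\le}(\mathcal H)$ the generalized fidelity is $$\bar F(\rho,\tau)=\sup_{\bar{\mathcal H}\supseteq\mathcal H}\ \sup\{F(\bar\rho,\bar\tau):\bar\rho,\bar\tau\in\mathcal S_{=}(\bar{\mathcal H}),\ \Pi\bar\rho\Pi=\rho,\ \Pi\bar\tau\Pi=\tau\},$$ where $\Pi$ is the projector of $\bar{\mathcal H}$ onto $\mathcal H$. The purified distance is $P(\rho,\tau)=\sqrt{1-\bar F(\rho,\tau)^2}$. For $0\le\varepsilon<\sqrt{\operatorname{tr}\rho}$ let $\mathcal B^\varepsilon(\rho)=\{\tau\in\mathcal S_{\le}(\mathcal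 H):P(\tau,\rho)\le\varepsilon\}$. For $\rho_{AB}\in\mathcal S_{\le}(\mathcal H_A\otimes\mathcal H_B)$ define the min-entropy and the smooth min-entropy by $$H_{\min}(A|B)_\rho=\sup_{\sigma_B\in\mathcal S_{=}(\mathcal H_B)}\sup\{\lambda\in\mathbb R:\rho_{AB}\le 2^{-\lambda}\,1_A\otimes\sigma_B\},\qquad H_{\min}^\varepsilon(A|B)_\rho=\sup_{\tilde\rho_{AB}\in\mathcal B^\varepsilon(\rho_{AB})}H_{\min}(A|B)_{\tilde\rho},$$ with suprema taken in the extended reals. The smooth max-entropy is defined by $$H_{\max}^\varepsilon(A|B)_\rho=-H_{\min}^\varepsilon(A|C)_\rho,$$ where $\rho_{ABC}$ is a purification of $\rho_{AB}$, that is, $\rho_{ABC}=|\psi\rangle\langle\psi|$ for a vector $\psi\in\mathcal H_A\otimes\mathcal H_B\otimes\mathcal H_C$, with $\operatorname{tr}_C\rho_{ABC}=\rho_{AB}$, and $\rho_{AC}=\operatorname{tr}_B\rho_{ABC}$. The non-smooth max-entropy is $H_{\max}(A|B)_\rho=H_{\max}^0(A|B)_\rho$. **Lemma.** Let $\rho_{AB}\in\mathcal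 S_{\le}(\mathcal H_A\otimes\mathcal H_B)$ and $0\le\varepsilon<\sqrt{\operatorname{tr}\rho_{AB}}$. Then $H_{\max}^\varepsilon(A|B)_\rho$ does not depend on the choice of the purification (nor on the purifying space $\mathcal H_C$), and $$H_{\max}^\varepsilon(A|B)_\rho=\min_{\tilde\rho_{AB}\in\mathcal B^\varepsilon(\rho_{AB})}H_{\max}(A|B)_{\tilde\rho},$$ where the minimum is attained. -/

import Mathlib

open scoped MatrixOrder ComplexOrder Kronecker

universe u v w

/-! Finite-dimensional Hilbert spaces are represented by coordinates: a system with a finite basis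
`n` has Hilbert space `ℂⁿ`, its operators are `Matrix n n ℂ`, and the tensor product of the systems
`A` and `B` has the basis `A × B`. The order `≤` on matrices is the Loewner order. -/

namespace SmoothEntropy

section States

variable {n : Type u} [Fintype n] [DecidableEq n]

/-- Normalized states: positive semidefinite operators of trace one. -/
def IsNormalized (ρ : Matrix n n ℂ) : Prop :=
  ρ.PosSemidef ∧ ρ.trace = 1

/-- Sub-normalized states: positive semidefinite operators with `0 < tr ρ ≤ 1`. -/
def IsSubnormalized (ρ : Matrix n n ℂ) : Prop :=
  ρ.PosSemidef ∧ 0 < ρ.trace.re ∧ ρ.trace.re ≤ 1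

/-- The Schatten 1-norm `tr √(X† X)`. -/
noncomputable def traceNorm (X : Matrix n n ℂ) : ℝ :=
  (CFC.sqrt (X.conjTranspose * X)).trace.re

/-- The fidelity `F(ρ, τ) = ‖√ρ √τ‖₁`. -/
noncomputable def fidelity (ρ τ : Matrix n n ℂ) : ℝ :=
  traceNorm (CFC.sqrt ρ * CFC.sqrt τ)

/-- The generalized fidelity: the supremum of `F(ρ', τ')` over all finite-dimensional Hilbert spaces
`H' ⊇ H` and all normalized states `ρ', τ'` on `H'` that compress to `ρ` and `τ` on `H`.
The space `H'` is written as `H ⊕ ℂᵏ`, so that compressing to `H` takes the upper left block. -/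
noncomputable def genFidelity (ρ τ : Matrix n n ℂ) : ℝ :=
  sSup {f : ℝ | ∃ (k : ℕ) (ρ' τ' : Matrix (n ⊕ Fin k) (n ⊕ Fin k) ℂ),
    IsNormalized ρ' ∧ IsNormalized τ' ∧ ρ'.toBlocks₁₁ = ρ ∧ τ'.toBlocks₁₁ = τ ∧
      f = fidelity ρ' τ'}

/-- The purified distance. -/
noncomputable def purifiedDistance (ρ τ : Matrix n n ℂ) : ℝ :=
  Real.sqrt (1 - genFidelity ρ τ ^ 2)

/-- The `ε`-ball of sub-normalized states around `ρ` in purified distance. -/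
def epsBall (ε : ℝ) (ρ : Matrix n n ℂ) : Set (Matrix n n ℂ) :=
  {τ | IsSubnormalized τ ∧ purifiedDistance τ ρ ≤ ε}

end States

section Purification

variable {n : Type u} {C : Type v}

/-- The partial trace over the second factor. -/
def traceRight [Fintype C] (ω : Matrix (n × C) (n × C) ℂ) : Matrix n n ℂ :=
  Matrix.of fun i j => ∑ c, ω (i, c) (j, c)

/-- `ω = |ψ⟩⟨ψ|` is a purification of `ρ` with purifying system `C`. -/
def IsPurification [Fintype C] (ρ : Matrix n n ℂ) (ω : Matrix (n × C) (n × C) ℂ) : Prop :=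
  (∃ ψ : n × C → ℂ, ω = Matrix.vecMulVec ψ (star ψ)) ∧ traceRight ω = ρ

/-- The marginal on `A ⊗ C` of an operator on `(A ⊗ B) ⊗ C`. -/
def marginalAC {A : Type u} {B : Type v} {C : Type w} [Fintype B]
    (ω : Matrix ((A × B) × C) ((A × B) × C) ℂ) : Matrix (A × C) (A × C) ℂ :=
  Matrix.of fun x y => ∑ b, ω ((x.1, b), x.2) ((y.1, b), y.2)

/-- The purification `|ψ⟩ = ∑ᵢ √ρ |i⟩ ⊗ |i⟩` of `ρ`, whose purifying system is a copy of the
original one. -/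
noncomputable def stdPurification [Fintype n] [DecidableEq n] (ρ : Matrix n n ℂ) :
    Matrix (n × n) (n × n) ℂ :=
  Matrix.vecMulVec (fun x => CFC.sqrt ρ x.1 x.2) (star fun x => CFC.sqrt ρ x.1 x.2)

theorem isPurification_stdPurification [Fintype n] [DecidableEq n] {ρ : Matrix n n ℂ}
    (hρ : ρ.PosSemidef) : IsPurification ρ (stdPurification ρ) := by
  refine ⟨⟨_, rfl⟩, ?_⟩
  have h1 : (CFC.sqrt ρ).IsHermitian := (Matrix.nonneg_iff_posSemidef.1 (CFC.sqrt_nonneg ρ)).1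
  have h2 : CFC.sqrt ρ * CFC.sqrt ρ = ρ := CFC.sqrt_mul_sqrt_self ρ hρ.nonneg
  ext i j
  conv_rhs => rw [← h2, Matrix.mul_apply]
  simp only [traceRight, stdPurification, Matrix.of_apply, Matrix.vecMulVec_apply, Pi.star_apply]
  exact Finset.sum_congr rfl fun c _ => by rw [h1.apply c j]

end Purification

section Entropies

variable {A : Type u} {B : Type v} [Fintype A] [DecidableEq A] [Fintype B] [DecidableEq B]

/-- The min-entropy `H_min(A|B)_ρ`: the supremum, over normalized states `σ` on `B` and real `l`
with `ρ ≤ 2^(-l) 1_A ⊗ σ`, of `l`, taken in the extended reals. -/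
noncomputable def minEntropy (ρ : Matrix (A × B) (A × B) ℂ) : EReal :=
  ⨆ σ ∈ {σ : Matrix B B ℂ | IsNormalized σ},
    ⨆ l ∈ {l : ℝ | ρ ≤ ((2 : ℝ) ^ (-l)) • ((1 : Matrix A A ℂ) ⊗ₖ σ)}, (l : EReal)

/-- The `ε`-smooth min-entropy `H_min^ε(A|B)_ρ`. -/
noncomputable def smoothMinEntropy (ε : ℝ) (ρ : Matrix (A × B) (A × B) ℂ) : EReal :=
  ⨆ τ ∈ epsBall ε ρ, minEntropy τ

/-- The `ε`-smooth max-entropy `H_max^ε(A|B)_ρ = -H_min^ε(A|C)_ρ` for a purification of `ρ` on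
`A ⊗ B ⊗ C`. -/
noncomputable def smoothMaxEntropy (ε : ℝ) (ρ : Matrix (A × B) (A × B) ℂ) : EReal :=
  -smoothMinEntropy ε (marginalAC (stdPurification ρ))

/-- The (non-smooth) max-entropy `H_max(A|B)_ρ = H_max^0(A|B)_ρ`. -/
noncomputable def maxEntropy (ρ : Matrix (A × B) (A × B) ℂ) : EReal :=
  smoothMaxEntropy 0 ρ

end Entropies

end SmoothEntropy

open SmoothEntropy

/-!
A purification of an operator `P` on `A ⊗ B` with purifying system `C` is the same thing as a
matrix `K` from `C` to `A ⊗ B` with `K K† = P`, and the complementary marginal on `A ⊗ C` is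
`regroup K (regroup K)†`. The whole argument takes place on the level of such square roots.

Two square roots of one operator differ by a contraction (`exists_isContraction_eq_mul`), so the
fidelity of `K K†` and `L L†` is the maximum of `Re ⟨L, K V⟩` over contractions `V`
(`fidelity_isGreatest`). Working with contractions in place of isometries makes Uhlmann's theorem
hold without any condition on the dimensions of the purifying systems. The price is that `L V` may
purify a smaller operator than `L L†`; this is harmless, since the missing weight only increases
the second term of the generalized fidelity `F + √((1 - tr ρ)(1 - tr τ))` (`genFidelity_eq`), and
since the min-entropy does not decrease when its argument becomes smaller or when a contraction
acts on the conditioning system (`minEntropy_le_of_le_conj`).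

Hence a state in the ball around `ρ_AB` has, up to a contraction, a purification close to that of
`ρ_AB`, whose marginal lies in the ball around `ρ_AC`
(`minEntropy_regroup_le_smoothMinEntropy`); conversely every state in the ball around `ρ_AC` is
dominated in min-entropy by the marginal of a pure state on `A ⊗ B ⊗ C` close to the purification of
`ρ_AB` (`exists_minEntropy_le_regroup`). Together these give the independence of the purification
and the two bounds relating the smooth max-entropy to the max-entropies of the states in the ball.
The minimum is attained because the vectors close to a given one form a compact set, on which the
min-entropy attains its maximum (`exists_forall_minEntropy_le`).
-/

namespace SmoothEntropy

open Matrix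

/-! ### Contractions and factorizations -/

section Contractions

variable {m n p q : Type*} [Fintype m] [Fintype n] [Fintype p] [Fintype q]

/-- A matrix of operator norm at most one, expressed through the Loewner order. -/
def IsContraction [DecidableEq m] (V : Matrix m p ℂ) : Prop :=
  V * Vᴴ ≤ 1

theorem conj_mono {X Y : Matrix n n ℂ} (h : X ≤ Y) (M : Matrix m n ℂ) :
    M * X * Mᴴ ≤ M * Y * Mᴴ := by
  rw [Matrix.le_iff] at h ⊢
  have := h.mul_mul_conjTranspose_same M
  rwa [Matrix.mul_sub, Matrix.sub_mul] at this

theorem trace_re_mono {X Y : Matrix n n ℂ} (h : X ≤ Y) : X.trace.re ≤ Y.trace.re := by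
  rw [Matrix.le_iff] at h
  have := (Complex.le_def.1 h.trace_nonneg).1
  simpa [Matrix.trace_sub] using this

/-- With `P = V† V` one has `P² ≤ P`, and `1 - P = (1 - P)² + (P - P²)`. -/
theorem IsContraction.conjTranspose [DecidableEq m] [DecidableEq p] {V : Matrix m p ℂ}
    (hV : IsContraction V) :
    IsContraction Vᴴ := by
  unfold IsContraction at hV ⊢
  have h1 := conj_mono hV Vᴴ
  rw [conjTranspose_conjTranspose, Matrix.mul_one] at h1
  rw [conjTranspose_conjTranspose]
  rw [Matrix.le_iff] at h1 ⊢
  have h2 := posSemidef_self_mul_conjTranspose (1 - Vᴴ * V)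
  have e : 1 - Vᴴ * V = (1 - Vᴴ * V) * (1 - Vᴴ * V)ᴴ + (Vᴴ * V - Vᴴ * (V * Vᴴ) * V) := by
    simp only [conjTranspose_sub, conjTranspose_one, conjTranspose_mul,
      conjTranspose_conjTranspose, Matrix.mul_sub, Matrix.sub_mul, Matrix.mul_one, Matrix.one_mul,
      Matrix.mul_assoc]
    abel
  rw [e]
  exact h2.add h1

theorem IsContraction.mul [DecidableEq m] [DecidableEq p] {V : Matrix m p ℂ}
    {W : Matrix p q ℂ} (hV : IsContraction V) (hW : IsContraction W) : IsContraction (V * W) := by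
  have h := conj_mono hW V
  unfold IsContraction at *
  rw [Matrix.mul_one] at h
  rw [conjTranspose_mul, ← Matrix.mul_assoc, Matrix.mul_assoc V]
  exact h.trans hV

theorem IsContraction.transpose [DecidableEq m] [DecidableEq p] {V : Matrix m p ℂ}
    (hV : IsContraction V) :
    IsContraction Vᵀ := by
  have h := hV.conjTranspose
  unfold IsContraction at *
  rw [Matrix.le_iff] at *
  have e : Vᵀ * Vᵀᴴ = (Vᴴ * Vᴴᴴ)ᵀ := by
    rw [transpose_mul, conjTranspose_conjTranspose]; rfl
  rw [e, ← transpose_one, ← transpose_sub]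
  exact h.transpose

theorem mul_mul_conjTranspose_le [DecidableEq n] {V : Matrix n p ℂ}
    (hV : IsContraction V) (L : Matrix m n ℂ) : L * V * (L * V)ᴴ ≤ L * Lᴴ := by
  have h := conj_mono hV L
  rw [Matrix.mul_one] at h
  rwa [conjTranspose_mul, ← Matrix.mul_assoc, Matrix.mul_assoc L]

/-- The Moore–Penrose inverse of a positive semidefinite matrix. -/
theorem exists_pseudoinverse [DecidableEq n] {P : Matrix n n ℂ} (hP : P.PosSemidef) :
    ∃ R : Matrix n n ℂ, Rᴴ = R ∧ P * R * P = P ∧ R * P * R = R := by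
  have hc : ∀ f : ℝ → ℝ, ContinuousOn f (spectrum ℝ P) := fun f =>
    P.finite_real_spectrum.continuousOn f
  have hs : IsSelfAdjoint P := hP.1
  have hid : cfc (fun x : ℝ => x) P = P := cfc_id' ℝ P
  -- The convention `0⁻¹ = 0` makes `x⁻¹` the right function on the kernel of `P`.
  refine ⟨cfc (fun x : ℝ => x⁻¹) P, ?_, ?_, ?_⟩
  · exact (cfc_predicate (R := ℝ) (fun x : ℝ => x⁻¹) P : IsSelfAdjoint _)
  · conv_lhs => lhs; lhs; rw [← hid]
    conv_lhs => rhs; rw [← hid]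
    rw [← cfc_mul _ _ P (hc _) (hc _), ← cfc_mul _ _ P (hc _) (hc _)]
    conv_rhs => rw [← hid]
    congr 1
    ext x
    by_cases hx : x = 0 <;> simp [hx]
  · conv_lhs => lhs; rhs; rw [← hid]
    rw [← cfc_mul _ _ P (hc _) (hc _), ← cfc_mul _ _ P (hc _) (hc _)]
    congr 1
    ext x
    by_cases hx : x = 0 <;> simp [hx]

/-- Douglas' factorization: two square roots of the same positive semidefinite matrix differ by a
contraction. -/
theorem exists_isContraction_eq_mul [DecidableEq n] [DecidableEq p] {K : Matrix n m ℂ}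
    {L : Matrix n p ℂ} (h : K * Kᴴ = L * Lᴴ) : ∃ V : Matrix p m ℂ, IsContraction V ∧ K = L * V := by
  obtain ⟨R, hR, hPRP, hRPR⟩ := exists_pseudoinverse (posSemidef_self_mul_conjTranspose L)
  set P := L * Lᴴ with hP
  have hPP : Pᴴ = P := by simp [hP]
  refine ⟨Lᴴ * R * K, ?_, ?_⟩
  -- `V V† = L† R L` is an orthogonal projection.
  · have e : Lᴴ * R * K * (Lᴴ * R * K)ᴴ = Lᴴ * R * L := by
      calc Lᴴ * R * K * (Lᴴ * R * K)ᴴ = Lᴴ * (R * (K * Kᴴ) * R) * L := by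
            simp only [conjTranspose_mul, conjTranspose_conjTranspose, hR, Matrix.mul_assoc]
        _ = Lᴴ * R * L := by rw [h, hRPR]
    have e2 : 1 - Lᴴ * R * L = (1 - Lᴴ * R * L) * (1 - Lᴴ * R * L)ᴴ := by
      have e3 : Lᴴ * R * L * (Lᴴ * R * L) = Lᴴ * R * L := by
        calc Lᴴ * R * L * (Lᴴ * R * L) = Lᴴ * (R * P * R) * L := by
              simp only [hP, Matrix.mul_assoc]
          _ = _ := by rw [hRPR]
      have e4 : (Lᴴ * R * L)ᴴ = Lᴴ * R * L := by
        simp only [conjTranspose_mul, conjTranspose_conjTranspose, hR, Matrix.mul_assoc]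
      rw [conjTranspose_sub, conjTranspose_one, e4, Matrix.mul_sub, Matrix.mul_one, Matrix.sub_mul,
        Matrix.one_mul, e3, sub_self, sub_zero]
    unfold IsContraction
    rw [e, Matrix.le_iff, e2]
    exact posSemidef_self_mul_conjTranspose _
  -- The columns of `K` lie in the range of `P`, on which `P R` is the identity.
  · have e : L * (Lᴴ * R * K) = P * R * K := by simp only [hP, Matrix.mul_assoc]
    rw [e, ← sub_eq_zero, ← self_mul_conjTranspose_eq_zero]
    calc (K - P * R * K) * (K - P * R * K)ᴴ
        = K * Kᴴ - K * Kᴴ * R * P - (P * R * (K * Kᴴ) - P * R * (K * Kᴴ) * R * P) := by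
          simp only [conjTranspose_sub, conjTranspose_mul, hR, hPP, Matrix.mul_sub,
            Matrix.sub_mul, Matrix.mul_assoc]
          abel
      _ = 0 := by rw [h, hPRP, hPRP]; simp

end Contractions

/-! ### Overlaps of square roots -/

section Overlap

variable {m n p : Type*} [Fintype m] [Fintype n] [Fintype p]

/-- The real part of the Hilbert–Schmidt inner product. -/
def overlap (K L : Matrix n m ℂ) : ℝ :=
  (Kᴴ * L).trace.re

theorem overlap_eq_sum (K L : Matrix n m ℂ) :
    overlap K L = ∑ i, ∑ j, (star (K i j) * L i j).re := by
  rw [overlap, Finset.sum_comm]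
  simp [Matrix.trace, Matrix.mul_apply]

theorem overlap_comm (K L : Matrix n m ℂ) : overlap K L = overlap L K := by
  have : (Kᴴ * L) = (Lᴴ * K)ᴴ := by simp
  rw [overlap, this, trace_conjTranspose, overlap]
  simp

theorem overlap_self (K : Matrix n m ℂ) : overlap K K = (K * Kᴴ).trace.re := by
  rw [overlap, Matrix.trace_mul_comm]

theorem overlap_self_eq_sum (K : Matrix n m ℂ) :
    overlap K K = ∑ i, ∑ j, ‖K i j‖ ^ 2 := by
  rw [overlap_eq_sum]
  refine Finset.sum_congr rfl fun i _ => Finset.sum_congr rfl fun j _ => ?_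
  rw [← Complex.normSq_eq_norm_sq, Complex.normSq_apply]
  simp

theorem overlap_self_nonneg (K : Matrix n m ℂ) : 0 ≤ overlap K K := by
  rw [overlap_self_eq_sum]; positivity

theorem overlap_mul_right (K : Matrix n m ℂ) (L : Matrix n p ℂ) (V : Matrix p m ℂ) :
    overlap K (L * V) = overlap (K * Vᴴ) L := by
  rw [overlap, overlap, conjTranspose_mul, conjTranspose_conjTranspose, ← Matrix.mul_assoc,
    Matrix.trace_mul_comm, Matrix.mul_assoc]

theorem overlap_sub_self (K L : Matrix n m ℂ) :
    overlap (K - L) (K - L) = overlap K K + overlap L L - 2 * overlap K L := by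
  have h := overlap_comm K L
  simp only [overlap, conjTranspose_sub, Matrix.mul_sub, Matrix.sub_mul, trace_sub,
    Complex.sub_re] at h ⊢
  linarith

theorem overlap_le_sqrt (K L : Matrix n m ℂ) :
    overlap K L ≤ Real.sqrt (overlap K K * overlap L L) := by
  rw [overlap_self_eq_sum, overlap_self_eq_sum, overlap_eq_sum, Real.sqrt_mul (by positivity)]
  simp only [← Fintype.sum_prod_type']
  refine le_trans (Finset.sum_le_sum fun x _ => ?_)
    (Real.sum_mul_le_sqrt_mul_sqrt Finset.univ (fun x : n × m => ‖K x.1 x.2‖)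
      (fun x => ‖L x.1 x.2‖))
  refine (Complex.re_le_norm _).trans ?_
  simp

theorem overlap_mul_self_le [DecidableEq p] {V : Matrix p m ℂ}
    (hV : IsContraction V) (L : Matrix n p ℂ) : overlap (L * V) (L * V) ≤ overlap L L := by
  rw [overlap_self, overlap_self]
  exact trace_re_mono (mul_mul_conjTranspose_le hV L)

end Overlap

/-! ### The fidelity as a maximal overlap -/

section Fidelity

variable {m n p : Type*} [Fintype m] [DecidableEq m] [Fintype n] [DecidableEq n]
  [Fintype p] [DecidableEq p]

theorem sqrt_conjTranspose_and_mul {P : Matrix n n ℂ}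
    (hP : P.PosSemidef) :
    (CFC.sqrt P)ᴴ = CFC.sqrt P ∧ CFC.sqrt P * (CFC.sqrt P)ᴴ = P := by
  have h1 : (CFC.sqrt P)ᴴ = CFC.sqrt P :=
    (Matrix.nonneg_iff_posSemidef.1 (CFC.sqrt_nonneg P)).1
  refine ⟨h1, ?_⟩
  rw [h1]
  exact CFC.sqrt_mul_sqrt_self P hP.nonneg

/-- For `S ≥ 0` and a contraction `U`, Cauchy–Schwarz for `√S` and `√S U` gives
`Re tr (S U) ≤ tr S`. -/
theorem trace_mul_re_le {S U : Matrix n n ℂ} (hS : S.PosSemidef) (hU : IsContraction U) :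
    (S * U).trace.re ≤ S.trace.re := by
  obtain ⟨h1, h2⟩ := sqrt_conjTranspose_and_mul hS
  set T := CFC.sqrt S
  have e1 : (S * U).trace.re = overlap T (T * U) := by
    rw [overlap, ← Matrix.mul_assoc, h1, ← h2, h1]
  have e2 : overlap T T = S.trace.re := by rw [overlap_self, h2]
  rw [e1, ← e2]
  refine (overlap_le_sqrt _ _).trans ?_
  rw [Real.sqrt_le_left (overlap_self_nonneg T), sq]
  exact mul_le_mul_of_nonneg_left (overlap_mul_self_le hU T) (overlap_self_nonneg T)

/-- The variational formula for the trace norm. -/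
theorem traceNorm_isGreatest (X : Matrix n n ℂ) :
    IsGreatest {f | ∃ V : Matrix n n ℂ, IsContraction V ∧ f = (X * V).trace.re} (traceNorm X) := by
  have hS : (CFC.sqrt (Xᴴ * X)).PosSemidef := Matrix.nonneg_iff_posSemidef.1 (CFC.sqrt_nonneg _)
  obtain ⟨h1, h2⟩ := sqrt_conjTranspose_and_mul (posSemidef_conjTranspose_mul_self X)
  unfold traceNorm
  set S := CFC.sqrt (Xᴴ * X)
  have h3 : S * Sᴴ = Xᴴ * Xᴴᴴ := by rw [h2, conjTranspose_conjTranspose]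
  constructor
  · obtain ⟨V, hV, e⟩ := exists_isContraction_eq_mul h3
    refine ⟨Vᴴ, hV.conjTranspose, ?_⟩
    have e' : S = Vᴴ * X := by
      rw [← h1, e, conjTranspose_mul, conjTranspose_conjTranspose]
    rw [Matrix.trace_mul_comm, ← e']
  · rintro f ⟨V, hV, rfl⟩
    obtain ⟨W, hW, e⟩ := exists_isContraction_eq_mul h3.symm
    have e' : X = Wᴴ * S := by
      rw [← conjTranspose_conjTranspose X, e, conjTranspose_mul, h1]
    have e2 : (X * V).trace = (S * (V * Wᴴ)).trace := by
      rw [e', Matrix.mul_assoc, Matrix.trace_mul_comm, Matrix.mul_assoc]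
    rw [e2]
    exact trace_mul_re_le hS (hV.mul hW.conjTranspose)

/-- Uhlmann's theorem, for arbitrary square roots `K` and `L` of the two operators and with
contractions in place of isometries. -/
theorem fidelity_isGreatest (K : Matrix n m ℂ) (L : Matrix n p ℂ) :
    IsGreatest {f | ∃ V : Matrix m p ℂ, IsContraction V ∧ f = overlap L (K * V)}
      (fidelity (K * Kᴴ) (L * Lᴴ)) := by
  obtain ⟨hK1, hK2⟩ := sqrt_conjTranspose_and_mul (posSemidef_self_mul_conjTranspose K)
  obtain ⟨hL1, hL2⟩ := sqrt_conjTranspose_and_mul (posSemidef_self_mul_conjTranspose L)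
  unfold fidelity
  set S := CFC.sqrt (K * Kᴴ)
  set T := CFC.sqrt (L * Lᴴ)
  have key : ∀ V : Matrix n n ℂ, (S * T * V).trace.re = overlap T (S * Vᴴ) := by
    intro V
    rw [overlap_mul_right, conjTranspose_conjTranspose, overlap_comm, overlap, hK1,
      Matrix.mul_assoc]
  constructor
  · obtain ⟨V, hV, e⟩ := (traceNorm_isGreatest (S * T)).1
    obtain ⟨X, hX, eX⟩ := exists_isContraction_eq_mul hK2
    obtain ⟨Y, hY, eY⟩ := exists_isContraction_eq_mul hL2
    refine ⟨X * Vᴴ * Yᴴ, (hX.mul hV.conjTranspose).mul hY.conjTranspose, ?_⟩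
    rw [e, key, eX, eY, ← Matrix.mul_assoc, overlap_mul_right _ _ Yᴴ, conjTranspose_conjTranspose,
      Matrix.mul_assoc K]
  · rintro f ⟨V, hV, rfl⟩
    obtain ⟨X, hX, eX⟩ := exists_isContraction_eq_mul hK2.symm
    obtain ⟨Y, hY, eY⟩ := exists_isContraction_eq_mul hL2.symm
    refine (traceNorm_isGreatest (S * T)).2
      ⟨(X * V * Yᴴ)ᴴ, ((hX.mul hV).mul hY.conjTranspose).conjTranspose, ?_⟩
    rw [key, conjTranspose_conjTranspose, ← Matrix.mul_assoc, overlap_mul_right _ _ Yᴴ,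
      conjTranspose_conjTranspose, ← eY, ← Matrix.mul_assoc, ← eX]

end Fidelity

/-! ### The generalized fidelity and the ball -/

section GenFidelity

variable {m n p k : Type*} [Fintype m] [Fintype n] [Fintype p] [Fintype k]

theorem isContraction_one [DecidableEq m] : IsContraction (1 : Matrix m m ℂ) := by
  simp [IsContraction]

theorem trace_re_nonneg {P : Matrix n n ℂ} (hP : P.PosSemidef) : 0 ≤ P.trace.re :=
  (Complex.le_def.1 hP.trace_nonneg).1

theorem isNormalized_mul_conjTranspose {K : Matrix n m ℂ} (h : overlap K K = 1) :
    IsNormalized (K * Kᴴ) := by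
  have hP := posSemidef_self_mul_conjTranspose K
  refine ⟨hP, Complex.ext ?_ ?_⟩
  · rw [← overlap_self, h]; rfl
  · exact (Complex.le_def.1 hP.trace_nonneg).2.symm

theorem overlap_rows (K L : Matrix (n ⊕ k) m ℂ) :
    overlap K L = overlap K.toRows₁ L.toRows₁ + overlap K.toRows₂ L.toRows₂ := by
  simp only [overlap_eq_sum, Fintype.sum_sum_type, toRows₁_apply, toRows₂_apply]

theorem overlap_fromBlocks (K L : Matrix n m ℂ) (X Y : Matrix k p ℂ) :
    overlap (fromBlocks K 0 0 X) (fromBlocks L 0 0 Y) = overlap K L + overlap X Y := by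
  simp [overlap_eq_sum, Fintype.sum_sum_type]

theorem IsContraction.fromBlocks_one [DecidableEq m] [DecidableEq k] {V : Matrix m p ℂ}
    (hV : IsContraction V) :
    IsContraction (fromBlocks V 0 0 (1 : Matrix k k ℂ)) := by
  unfold IsContraction at *
  rw [Matrix.le_iff] at *
  have h := hV.mul_mul_conjTranspose_same (fromRows 1 0 : Matrix (m ⊕ k) m ℂ)
  convert h using 1
  rw [fromBlocks_conjTranspose, fromBlocks_multiply, ← Matrix.fromBlocks_one,
    conjTranspose_fromRows_eq_fromCols_conjTranspose, fromRows_mul, fromRows_mul_fromCols]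
  ext (i | i) (j | j) <;> simp [Matrix.one_apply]

theorem fidelity_nonneg [DecidableEq n] (ρ τ : Matrix n n ℂ) : 0 ≤ fidelity ρ τ :=
  trace_re_nonneg (Matrix.nonneg_iff_posSemidef.1 (CFC.sqrt_nonneg _))

/-- The supremum over extensions is attained by adding one dimension that carries the missing
weight of both states. -/
theorem genFidelity_eq [DecidableEq n] {ρ τ : Matrix n n ℂ} (hρ : ρ.PosSemidef)
    (hρ1 : ρ.trace.re ≤ 1) (hτ : τ.PosSemidef) (hτ1 : τ.trace.re ≤ 1) :
    genFidelity ρ τ = fidelity ρ τ + Real.sqrt ((1 - ρ.trace.re) * (1 - τ.trace.re)) := by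
  -- An extension splits into its blocks on `n` and on `Fin k`: the first contributes at most the
  -- fidelity, the second is bounded by Cauchy–Schwarz.
  have ub : ∀ f ∈ {f : ℝ | ∃ (k : ℕ) (ρ' τ' : Matrix (n ⊕ Fin k) (n ⊕ Fin k) ℂ),
      IsNormalized ρ' ∧ IsNormalized τ' ∧ ρ'.toBlocks₁₁ = ρ ∧ τ'.toBlocks₁₁ = τ ∧
      f = fidelity ρ' τ'},
      f ≤ fidelity ρ τ + Real.sqrt ((1 - ρ.trace.re) * (1 - τ.trace.re)) := by
    rintro f ⟨k, ρ', τ', ⟨hρ', hρt⟩, ⟨hτ', hτt⟩, e1, e2, rfl⟩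
    obtain ⟨-, hK⟩ := sqrt_conjTranspose_and_mul hρ'
    obtain ⟨-, hL⟩ := sqrt_conjTranspose_and_mul hτ'
    set K := CFC.sqrt ρ'
    set L := CFC.sqrt τ'
    have eK : K.toRows₁ * K.toRows₁ᴴ = ρ := by
      rw [← e1, ← hK]; ext i j; rfl
    have eL : L.toRows₁ * L.toRows₁ᴴ = τ := by
      rw [← e2, ← hL]; ext i j; rfl
    have tK : overlap K.toRows₂ K.toRows₂ = 1 - ρ.trace.re := by
      have h := overlap_rows K K
      rw [overlap_self, hK, hρt, overlap_self K.toRows₁, eK, Complex.one_re] at h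
      linarith
    have tL : overlap L.toRows₂ L.toRows₂ = 1 - τ.trace.re := by
      have h := overlap_rows L L
      rw [overlap_self, hL, hτt, overlap_self L.toRows₁, eL, Complex.one_re] at h
      linarith
    obtain ⟨V, hV, e⟩ := (fidelity_isGreatest K L).1
    rw [hK, hL] at e
    rw [e, overlap_rows]
    have r1 : (K * V).toRows₁ = K.toRows₁ * V := rfl
    have r2 : (K * V).toRows₂ = K.toRows₂ * V := rfl
    rw [r1, r2]
    have b1 := (fidelity_isGreatest K.toRows₁ L.toRows₁).2 ⟨V, hV, rfl⟩
    rw [eK, eL] at b1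
    refine add_le_add b1 ((overlap_le_sqrt _ _).trans (Real.sqrt_le_sqrt ?_))
    rw [mul_comm, ← tK, ← tL]
    exact mul_le_mul_of_nonneg_right (overlap_mul_self_le hV _) (overlap_self_nonneg _)
  obtain ⟨-, hK⟩ := sqrt_conjTranspose_and_mul hρ
  obtain ⟨-, hL⟩ := sqrt_conjTranspose_and_mul hτ
  set K := CFC.sqrt ρ
  set L := CFC.sqrt τ
  let D : ℝ → Matrix (Fin 1) (Fin 1) ℂ := fun t => of fun _ _ => (Real.sqrt t : ℂ)
  -- `D t` is the square root of the weight `t` on the additional dimension.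
  have hD : ∀ s t : ℝ, overlap (D s) (D t) = Real.sqrt s * Real.sqrt t := by
    intro s t; simp [overlap_eq_sum, D]
  have hD2 : ∀ t : ℝ, 0 ≤ t → overlap (D t) (D t) = t := by
    intro t ht; rw [hD, Real.mul_self_sqrt ht]
  have hext : ∀ (X : Matrix n n ℂ), (X * Xᴴ).trace.re ≤ 1 →
      IsNormalized (fromBlocks X 0 0 (D (1 - (X * Xᴴ).trace.re)) *
        (fromBlocks X 0 0 (D (1 - (X * Xᴴ).trace.re)))ᴴ) := by
    intro X hX
    apply isNormalized_mul_conjTranspose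
    rw [overlap_fromBlocks, hD2 _ (by linarith), overlap_self]
    ring
  have hblock : ∀ (X : Matrix n n ℂ) (Y : Matrix (Fin 1) (Fin 1) ℂ),
      (fromBlocks X 0 0 Y * (fromBlocks X 0 0 Y)ᴴ).toBlocks₁₁ = X * Xᴴ := by
    intro X Y
    rw [fromBlocks_conjTranspose, fromBlocks_multiply, toBlocks_fromBlocks₁₁]
    simp
  have mem : fidelity
      (fromBlocks K 0 0 (D (1 - (K * Kᴴ).trace.re)) *
        (fromBlocks K 0 0 (D (1 - (K * Kᴴ).trace.re)))ᴴ)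
      (fromBlocks L 0 0 (D (1 - (L * Lᴴ).trace.re)) *
        (fromBlocks L 0 0 (D (1 - (L * Lᴴ).trace.re)))ᴴ) ∈
      {f : ℝ | ∃ (k : ℕ) (ρ' τ' : Matrix (n ⊕ Fin k) (n ⊕ Fin k) ℂ),
      IsNormalized ρ' ∧ IsNormalized τ' ∧ ρ'.toBlocks₁₁ = ρ ∧ τ'.toBlocks₁₁ = τ ∧
      f = fidelity ρ' τ'} :=
    ⟨1, _, _, hext K (by rwa [hK]), hext L (by rwa [hL]), (hblock K _).trans hK,
      (hblock L _).trans hL, rfl⟩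
  refine le_antisymm (csSup_le ⟨_, mem⟩ ub) (le_csSup_of_le ⟨_, ub⟩ mem ?_)
  obtain ⟨V, hV, e⟩ := (fidelity_isGreatest K L).1
  refine le_trans (le_of_eq ?_)
    ((fidelity_isGreatest _ _).2 ⟨fromBlocks V 0 0 1, hV.fromBlocks_one, rfl⟩)
  rw [hK, hL] at e
  rw [e, fromBlocks_multiply]
  simp only [Matrix.mul_zero, Matrix.zero_mul, add_zero, zero_add, Matrix.mul_one]
  rw [overlap_fromBlocks, hD, hK, hL, mul_comm (Real.sqrt _), ← Real.sqrt_mul (by linarith)]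

/-- Membership in the ball in terms of the fidelity. A matrix of trace zero is excluded by
`ε < √(tr ρ)`. -/
theorem mem_epsBall_iff [DecidableEq n] {ε : ℝ} (hε : 0 ≤ ε) {ρ τ : Matrix n n ℂ}
    (hρ : ρ.PosSemidef) (hρ1 : ρ.trace.re ≤ 1) (hερ : ε < Real.sqrt ρ.trace.re) :
    τ ∈ epsBall ε ρ ↔ τ.PosSemidef ∧ τ.trace.re ≤ 1 ∧ Real.sqrt (1 - ε ^ 2) ≤
      fidelity τ ρ + Real.sqrt ((1 - τ.trace.re) * (1 - ρ.trace.re)) := by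
  have hε2 : ε ^ 2 < ρ.trace.re := (Real.lt_sqrt hε).1 hερ
  have key : τ.PosSemidef → τ.trace.re ≤ 1 → (purifiedDistance τ ρ ≤ ε ↔ Real.sqrt (1 - ε ^ 2) ≤
      fidelity τ ρ + Real.sqrt ((1 - τ.trace.re) * (1 - ρ.trace.re))) := by
    intro h1 h2
    have h0 := fidelity_nonneg τ ρ
    rw [purifiedDistance, genFidelity_eq h1 h2 hρ hρ1, Real.sqrt_le_left hε,
      Real.sqrt_le_left (by positivity)]
    constructor <;> intro h <;> linarith
  constructor
  · rintro ⟨⟨h1, -, h2⟩, h3⟩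
    exact ⟨h1, h2, (key h1 h2).1 h3⟩
  · rintro ⟨h1, h2, h3⟩
    refine ⟨⟨h1, lt_of_le_of_ne (trace_re_nonneg h1) fun h => ?_, h2⟩, (key h1 h2).2 h3⟩
    have h4 : τ = 0 := by
      rw [← h1.trace_eq_zero_iff]
      exact Complex.ext h.symm (Complex.le_def.1 h1.trace_nonneg).2.symm
    rw [h4] at h3
    simp only [fidelity, traceNorm, CFC.sqrt_zero, Matrix.zero_mul, Matrix.mul_zero,
      Matrix.trace_zero, Complex.zero_re, sub_zero, zero_add, one_mul] at h3
    rw [Real.sqrt_le_sqrt_iff (by linarith)] at h3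
    linarith

/-- The generalized fidelity of two pure sub-normalized states, up to the phase of the inner
product. -/
noncomputable def genOverlap (K L : Matrix n m ℂ) : ℝ :=
  overlap K L + Real.sqrt ((1 - overlap K K) * (1 - overlap L L))

/-- The purified distance does not increase under the partial trace. -/
theorem mul_conjTranspose_mem_epsBall [DecidableEq n] [DecidableEq m] {ε : ℝ} (hε : 0 ≤ ε)
    {K L : Matrix n m ℂ} (hK : overlap K K ≤ 1) (hεK : ε < Real.sqrt (overlap K K))
    (hL : overlap L L ≤ 1) (h : Real.sqrt (1 - ε ^ 2) ≤ genOverlap K L) :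
    L * Lᴴ ∈ epsBall ε (K * Kᴴ) := by
  rw [overlap_self] at hK hεK
  rw [mem_epsBall_iff hε (posSemidef_self_mul_conjTranspose K) hK hεK]
  refine ⟨posSemidef_self_mul_conjTranspose L, by rwa [← overlap_self], h.trans ?_⟩
  unfold genOverlap
  rw [overlap_self, overlap_self, mul_comm]
  refine add_le_add_left ((fidelity_isGreatest L K).2 ⟨1, isContraction_one, ?_⟩) _
  rw [Matrix.mul_one]

/-- Every state of the ball has an approximate purification close to a given purification `K` of
the center: since `V` is a contraction and not an isometry, `L V` may purify a smaller operator
than `L L†`, whatever the dimension of the purifying system of `K`. -/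
theorem exists_genOverlap_of_mem_epsBall [DecidableEq n] [DecidableEq m] [DecidableEq p] {ε : ℝ}
    (hε : 0 ≤ ε) {K : Matrix n m ℂ} {L : Matrix n p ℂ} (hK : overlap K K ≤ 1)
    (hεK : ε < Real.sqrt (overlap K K)) (h : L * Lᴴ ∈ epsBall ε (K * Kᴴ)) :
    ∃ V : Matrix p m ℂ, IsContraction V ∧ overlap (L * V) (L * V) ≤ 1 ∧
      Real.sqrt (1 - ε ^ 2) ≤ genOverlap K (L * V) := by
  rw [overlap_self] at hK hεK
  obtain ⟨-, h1, h2⟩ := (mem_epsBall_iff hε (posSemidef_self_mul_conjTranspose K) hK hεK).1 h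
  obtain ⟨V, hV, e⟩ := (fidelity_isGreatest L K).1
  have h3 := overlap_mul_self_le hV L
  rw [← overlap_self] at h1
  refine ⟨V, hV, h3.trans h1, h2.trans ?_⟩
  unfold genOverlap
  rw [e, mul_comm, ← overlap_self, ← overlap_self]
  gcongr
  rwa [sub_nonneg, overlap_self]

end GenFidelity

/-! ### The min-entropy -/

section MinEntropy

variable {A : Type u} {C : Type v} {D : Type w} [DecidableEq A] [Fintype C] [Fintype D]

theorem one_kronecker_mono [Fintype A] {X Y : Matrix C C ℂ} (h : X ≤ Y) :
    (1 : Matrix A A ℂ) ⊗ₖ X ≤ 1 ⊗ₖ Y := by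
  rw [Matrix.le_iff] at *
  have := PosSemidef.one (n := A) (R := ℂ) |>.kronecker h
  convert this using 1
  ext i j
  simp [kroneckerMap_apply, mul_sub]

theorem real_smul_mono {n : Type*} {X Y : Matrix n n ℂ} (h : X ≤ Y) {s : ℝ} (hs : 0 ≤ s) :
    s • X ≤ s • Y := by
  rw [Matrix.le_iff] at *
  rw [← smul_sub]
  exact h.smul hs

/-- The min-entropy does not decrease when a contraction acts on the conditioning system and the
operator is made smaller: `W σ W†` has trace at most one and lies below a normalized state. -/
theorem minEntropy_le_of_le_conj [Fintype A] [DecidableEq C] [DecidableEq D] [Nonempty D]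
    {P : Matrix (A × C) (A × C) ℂ} {Q : Matrix (A × D) (A × D) ℂ} {W : Matrix D C ℂ}
    (hW : IsContraction W) (h : Q ≤ ((1 : Matrix A A ℂ) ⊗ₖ W) * P * ((1 : Matrix A A ℂ) ⊗ₖ W)ᴴ) :
    minEntropy P ≤ minEntropy Q := by
  unfold minEntropy
  refine iSup₂_le fun σ hσ => iSup₂_le fun l hl => ?_
  obtain ⟨hσ1, hσ2⟩ := hσ
  have hP := hσ1.mul_mul_conjTranspose_same W
  have htr : (W * σ * Wᴴ).trace.re ≤ 1 := by
    obtain ⟨hT1, hT2⟩ := sqrt_conjTranspose_and_mul hσ1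
    set T := CFC.sqrt σ
    have e1 : (W * σ * Wᴴ).trace.re = overlap (T * Wᴴ) (T * Wᴴ) := by
      rw [overlap, conjTranspose_mul, conjTranspose_conjTranspose, hT1, ← hT2, hT1]
      simp only [Matrix.mul_assoc]
    have e2 : overlap T T = 1 := by rw [overlap_self, hT2, hσ2]; rfl
    rw [e1, ← e2]
    exact overlap_mul_self_le hW.conjTranspose T
  obtain ⟨d⟩ := ‹Nonempty D›
  let Z : Matrix D D ℂ := (1 - (W * σ * Wᴴ).trace.re) • Matrix.single d d 1
  have hZ : Z.PosSemidef := by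
    have : (Matrix.single d d (1 : ℂ)).PosSemidef := by
      have := posSemidef_self_mul_conjTranspose (Matrix.single d d (1 : ℂ))
      simpa using this
    exact this.smul (by linarith)
  have hσ' : IsNormalized (W * σ * Wᴴ + Z) := by
    refine ⟨hP.add hZ, ?_⟩
    have him := (Complex.le_def.1 hP.trace_nonneg).2
    apply Complex.ext
    · simp [Z, Matrix.trace_add]
    · simpa [Z, Matrix.trace_add, Matrix.trace_smul] using him.symm
  refine le_iSup₂_of_le (W * σ * Wᴴ + Z) hσ' (le_iSup₂_of_le l ?_ le_rfl)
  have hl' : P ≤ ((2 : ℝ) ^ (-l)) • ((1 : Matrix A A ℂ) ⊗ₖ σ) := hl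
  have h2 := h.trans (conj_mono hl' _)
  refine h2.trans ?_
  have e : ((1 : Matrix A A ℂ) ⊗ₖ W) * (((2 : ℝ) ^ (-l)) • ((1 : Matrix A A ℂ) ⊗ₖ σ)) *
      ((1 : Matrix A A ℂ) ⊗ₖ W)ᴴ = ((2 : ℝ) ^ (-l)) • ((1 : Matrix A A ℂ) ⊗ₖ (W * σ * Wᴴ)) := by
    rw [conjTranspose_kronecker, Matrix.mul_smul, Matrix.smul_mul, ← mul_kronecker_mul,
      ← mul_kronecker_mul, conjTranspose_one, Matrix.mul_one, Matrix.mul_one]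
  rw [e]
  refine real_smul_mono (one_kronecker_mono ?_) (by positivity)
  rw [Matrix.le_iff, add_sub_cancel_left]
  exact hZ

theorem minEntropy_anti [Fintype A] [DecidableEq C] [Nonempty C]
    {P Q : Matrix (A × C) (A × C) ℂ} (h : Q ≤ P) :
    minEntropy P ≤ minEntropy Q :=
  minEntropy_le_of_le_conj (W := 1) isContraction_one (by simpa using h)

/-- A witness `P ≤ 1 ⊗ Y Y†` for the min-entropy; the normalized state is `Y Y† / tr (Y Y†)`. -/
theorem neg_logb_le_minEntropy {P : Matrix (A × C) (A × C) ℂ} {Y : Matrix C C ℂ}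
    (hY : 0 < overlap Y Y) (h : P ≤ (1 : Matrix A A ℂ) ⊗ₖ (Y * Yᴴ)) :
    ((-Real.logb 2 (overlap Y Y) : ℝ) : EReal) ≤ minEntropy P := by
  have hPSD := posSemidef_self_mul_conjTranspose Y
  have him := (Complex.le_def.1 hPSD.trace_nonneg).2
  have hre : (Y * Yᴴ).trace.re = overlap Y Y := (overlap_self Y).symm
  unfold minEntropy
  refine le_iSup₂_of_le ((overlap Y Y)⁻¹ • (Y * Yᴴ)) ⟨hPSD.smul (by positivity), ?_⟩
    (le_iSup₂_of_le (-Real.logb 2 (overlap Y Y)) ?_ le_rfl)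
  · rw [trace_smul]
    apply Complex.ext
    · rw [Complex.smul_re, hre, smul_eq_mul, inv_mul_cancel₀ hY.ne']; rfl
    · rw [Complex.smul_im, ← him]; simp
  · show P ≤ _
    rw [neg_neg, Real.rpow_logb (by norm_num) (by norm_num) hY, kronecker_smul, smul_smul,
      mul_inv_cancel₀ hY.ne', one_smul]
    exact h

theorem minEntropy_le_neg_logb [DecidableEq C] {P : Matrix (A × C) (A × C) ℂ} {t : ℝ}
    (ht : 0 < t) (h : ∀ Y : Matrix C C ℂ, P ≤ (1 : Matrix A A ℂ) ⊗ₖ (Y * Yᴴ) → t ≤ overlap Y Y) :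
    minEntropy P ≤ ((-Real.logb 2 t : ℝ) : EReal) := by
  unfold minEntropy
  refine iSup₂_le fun σ hσ => iSup₂_le fun l hl => ?_
  have hl' : P ≤ ((2 : ℝ) ^ (-l)) • ((1 : Matrix A A ℂ) ⊗ₖ σ) := hl
  have hs : 0 < (2 : ℝ) ^ (-l) := by positivity
  have hPSD : (((2 : ℝ) ^ (-l)) • σ).PosSemidef := hσ.1.smul hs.le
  obtain ⟨-, hT⟩ := sqrt_conjTranspose_and_mul hPSD
  have h1 := h (CFC.sqrt (((2 : ℝ) ^ (-l)) • σ)) (by rwa [hT, kronecker_smul])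
  rw [overlap_self, hT, trace_smul, hσ.2] at h1
  simp only [Complex.smul_re, Complex.one_re, smul_eq_mul, mul_one] at h1
  rw [EReal.coe_le_coe_iff, le_neg, Real.logb_le_iff_le_rpow (by norm_num) ht]
  exact h1

theorem trace_le_card_mul_overlap [Fintype A] {P : Matrix (A × C) (A × C) ℂ}
    {Y : Matrix C C ℂ} (h : P ≤ (1 : Matrix A A ℂ) ⊗ₖ (Y * Yᴴ)) :
    P.trace.re ≤ Fintype.card A * overlap Y Y := by
  refine (trace_re_mono h).trans (le_of_eq ?_)
  rw [trace_kronecker, trace_one, overlap_self]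
  simp

theorem le_one_of_trace_le_one {n : Type*} [Fintype n] [DecidableEq n] {P : Matrix n n ℂ}
    (hP : P.PosSemidef) (h : P.trace.re ≤ 1) : P ≤ 1 := by
  have h1 : P ≤ algebraMap ℝ _ 1 := by
    refine le_algebraMap_of_spectrum_le (fun x hx => ?_) hP.1
    rw [hP.1.spectrum_real_eq_range_eigenvalues] at hx
    obtain ⟨i, rfl⟩ := hx
    refine le_trans ?_ h
    rw [hP.1.trace_eq_sum_eigenvalues]
    simp only [Complex.re_sum]
    exact Finset.single_le_sum (f := hP.1.eigenvalues) (fun j _ => hP.eigenvalues_nonneg j)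
      (Finset.mem_univ i)
  simpa using h1

end MinEntropy

section Compactness

variable {m n : Type*} [Fintype m] [Fintype n]

theorem isClosed_posSemidef : IsClosed {P : Matrix n n ℂ | P.PosSemidef} := by
  simp only [posSemidef_iff_dotProduct_mulVec, Set.ofPred_and, Set.ofPred_forall]
  refine IsClosed.inter ?_ (isClosed_iInter fun x => ?_)
  · exact isClosed_eq (by fun_prop) continuous_id
  · exact isClosed_le continuous_const (by fun_prop)

theorem continuous_overlap {X : Type*} [TopologicalSpace X] {f g : X → Matrix n m ℂ}
    (hf : Continuous f) (hg : Continuous g) : Continuous fun x => overlap (f x) (g x) := by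
  unfold overlap
  fun_prop

theorem isCompact_overlap_le (M : ℝ) : IsCompact {K : Matrix n m ℂ | overlap K K ≤ M} := by
  have hK : IsCompact (Set.univ.pi fun _ : n => Set.univ.pi fun _ : m =>
      Metric.closedBall (0 : ℂ) (Real.sqrt M)) :=
    isCompact_univ_pi fun _ => isCompact_univ_pi fun _ => isCompact_closedBall _ _
  refine IsCompact.of_isClosed_subset hK
    (isClosed_le (continuous_overlap continuous_id continuous_id) continuous_const) ?_
  intro K hKM i _ j _
  rw [mem_closedBall_zero_iff]
  refine Real.le_sqrt_of_sq_le (le_trans ?_ hKM)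
  rw [overlap_self_eq_sum]
  refine le_trans ?_ (Finset.single_le_sum (f := fun i => ∑ j, ‖K i j‖ ^ 2)
    (fun i _ => by positivity) (Finset.mem_univ i))
  exact Finset.single_le_sum (f := fun j => ‖K i j‖ ^ 2)
    (fun j _ => by positivity) (Finset.mem_univ j)

theorem genOverlap_self {K : Matrix n m ℂ} (hK : overlap K K ≤ 1) : genOverlap K K = 1 := by
  rw [genOverlap, Real.sqrt_mul_self (by linarith)]
  ring

end Compactness

/-- Among the vectors close to `K`, one has a maximal min-entropy: the pairs `(L, Y)` with `L` close
to `K`, `L L† ≤ 1 ⊗ Y Y†` and bounded `tr (Y Y†)` form a compact set, and `-log₂ tr (Y Y†)` is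
maximal at some pair. -/
theorem exists_forall_minEntropy_le {A : Type u} {B : Type v} {C : Type w} [Fintype A]
    [DecidableEq A] [Fintype B] [Fintype C] [DecidableEq C] {K : Matrix (A × C) B ℂ} {c : ℝ}
    (hK : overlap K K ≤ 1) (hc : c ≤ 1)
    (hpos : ∀ L : Matrix (A × C) B ℂ, overlap L L ≤ 1 → c ≤ genOverlap K L → 0 < overlap L L) :
    ∃ L : Matrix (A × C) B ℂ, overlap L L ≤ 1 ∧ c ≤ genOverlap K L ∧
      ∀ L' : Matrix (A × C) B ℂ, overlap L' L' ≤ 1 → c ≤ genOverlap K L' →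
        minEntropy (L' * L'ᴴ) ≤ minEntropy (L * Lᴴ) := by
  -- `Y = 1` is a witness for every `L`, so larger values of `tr (Y Y†)` are irrelevant.
  let M : ℝ := overlap (1 : Matrix C C ℂ) 1
  let S : Set (Matrix (A × C) B ℂ × Matrix C C ℂ) :=
    {x | overlap x.1 x.1 ≤ 1} ∩ ({x | c ≤ genOverlap K x.1} ∩
      ({x | x.1 * x.1ᴴ ≤ (1 : Matrix A A ℂ) ⊗ₖ (x.2 * x.2ᴴ)} ∩ {x | overlap x.2 x.2 ≤ M}))
  have hSc : IsClosed S := by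
    refine (isClosed_le (continuous_overlap continuous_fst continuous_fst)
      continuous_const).inter ((isClosed_le continuous_const ?_).inter (IsClosed.inter ?_
        (isClosed_le (continuous_overlap continuous_snd continuous_snd) continuous_const)))
    · unfold genOverlap
      have h1 : Continuous fun x : Matrix (A × C) B ℂ × Matrix C C ℂ => overlap K x.1 :=
        continuous_overlap continuous_const continuous_fst
      have h2 : Continuous fun x : Matrix (A × C) B ℂ × Matrix C C ℂ => overlap x.1 x.1 :=
        continuous_overlap continuous_fst continuous_fst
      fun_prop
    · simp only [Matrix.le_iff]
      refine isClosed_posSemidef.preimage (f := fun x : Matrix (A × C) B ℂ × Matrix C C ℂ =>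
        (1 : Matrix A A ℂ) ⊗ₖ (x.2 * x.2ᴴ) - x.1 * x.1ᴴ) ?_
      refine Continuous.sub (continuous_matrix fun i j => ?_) (by fun_prop)
      simp only [kroneckerMap_apply]
      fun_prop
  have hS : IsCompact S :=
    ((isCompact_overlap_le 1).prod (isCompact_overlap_le M)).of_isClosed_subset hSc
      fun x hx => ⟨hx.1, hx.2.2.2⟩
  have hne : S.Nonempty := by
    refine ⟨(K, 1), hK, hc.trans_eq (genOverlap_self hK).symm, ?_, le_refl M⟩
    simp only [Set.mem_ofPred_eq, conjTranspose_one, Matrix.mul_one, one_kronecker_one]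
    exact le_one_of_trace_le_one (posSemidef_self_mul_conjTranspose K) (by rwa [← overlap_self])
  obtain ⟨⟨L, Y⟩, ⟨h1, h2, h3, h4⟩, hmin⟩ := hS.exists_isMinOn hne
    (continuous_overlap continuous_snd continuous_snd).continuousOn
  have hY : 0 < overlap Y Y := by
    have h5 := trace_le_card_mul_overlap h3
    have h6 := hpos L h1 h2
    rw [← overlap_self] at h5
    refine lt_of_le_of_ne (overlap_self_nonneg Y) fun h0 => ?_
    simp only at h5 h6
    rw [← h0, mul_zero] at h5
    linarith
  refine ⟨L, h1, h2, fun L' h1' h2' => le_trans ?_ (neg_logb_le_minEntropy hY h3)⟩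
  refine minEntropy_le_neg_logb hY fun Y' h3' => ?_
  by_cases h4' : overlap Y' Y' ≤ M
  · exact isMinOn_iff.1 hmin (L', Y') ⟨h1', h2', h3', h4'⟩
  · exact h4.trans (not_le.1 h4').le

/-! ### Tripartite vectors and duality -/

section Duality

variable {A : Type u} {B : Type v} {C : Type w} [Fintype A] [DecidableEq A] [Fintype B]
  [DecidableEq B] [Fintype C] [DecidableEq C]

/-- A vector in `A ⊗ B ⊗ C`, viewed as a matrix from `C` to `A ⊗ B`, becomes a matrix from `B` to
`A ⊗ C`. -/
def regroup {A B C : Type*} (φ : Matrix (A × B) C ℂ) : Matrix (A × C) B ℂ :=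
  of fun x b => φ (x.1, b) x.2

theorem overlap_regroup {A B C : Type*} [Fintype A] [Fintype B] [Fintype C]
    (φ χ : Matrix (A × B) C ℂ) : overlap (regroup φ) (regroup χ) = overlap φ χ := by
  simp only [overlap_eq_sum, Fintype.sum_prod_type, regroup, of_apply]
  exact Finset.sum_congr rfl fun a _ => Finset.sum_comm

theorem genOverlap_regroup {A B C : Type*} [Fintype A] [Fintype B] [Fintype C]
    (φ χ : Matrix (A × B) C ℂ) : genOverlap (regroup φ) (regroup χ) = genOverlap φ χ := by
  simp only [genOverlap, overlap_regroup]

theorem regroup_mul {A B C D : Type*} [Fintype A] [DecidableEq A] [Fintype C]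
    (φ : Matrix (A × B) C ℂ) (V : Matrix C D ℂ) :
    regroup (φ * V) = ((1 : Matrix A A ℂ) ⊗ₖ Vᵀ) * regroup φ := by
  ext ⟨a, d⟩ b
  simp [regroup, Matrix.mul_apply, Fintype.sum_prod_type, Matrix.one_apply, mul_comm]

theorem marginalAC_vecMulVec {A : Type u} {B : Type v} {C : Type w} [Fintype B]
    (ψ : (A × B) × C → ℂ) :
    marginalAC (vecMulVec ψ (star ψ)) =
      regroup (of fun x c => ψ (x, c)) * (regroup (of fun x c => ψ (x, c)))ᴴ := by
  ext x y
  simp [marginalAC, regroup, Matrix.mul_apply, vecMulVec_apply]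

theorem traceRight_vecMulVec {n : Type u} {C : Type v} [Fintype C] (ψ : n × C → ℂ) :
    traceRight (vecMulVec ψ (star ψ)) =
      (of fun x c => ψ (x, c) : Matrix n C ℂ) * (of fun x c => ψ (x, c))ᴴ := by
  ext x y
  simp [traceRight, Matrix.mul_apply, vecMulVec_apply]

theorem nonempty_of_overlap_pos {n m : Type*} [Fintype n] [Fintype m] {K : Matrix n m ℂ}
    (h : 0 < overlap K K) : Nonempty m := by
  by_contra hm
  rw [not_nonempty_iff] at hm
  simp [overlap_eq_sum] at h

/-- A state close to `ρ_AB` has a purification close to a given one of `ρ_AB`, up to a contraction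
on the purifying system, which does not decrease the min-entropy. -/
theorem minEntropy_regroup_le_smoothMinEntropy {D : Type*} [Fintype D] [DecidableEq D] {ε : ℝ}
    (hε : 0 ≤ ε) {K : Matrix (A × B) D ℂ} {L : Matrix (A × B) C ℂ} (hK : overlap K K ≤ 1)
    (hεK : ε < Real.sqrt (overlap K K)) (h : L * Lᴴ ∈ epsBall ε (K * Kᴴ)) :
    minEntropy (regroup L * (regroup L)ᴴ) ≤
      smoothMinEntropy ε (regroup K * (regroup K)ᴴ) := by
  have : Nonempty D := nonempty_of_overlap_pos (Real.sqrt_pos.1 (hε.trans_lt hεK))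
  obtain ⟨V, hV, h1, h2⟩ := exists_genOverlap_of_mem_epsBall hε hK hεK h
  rw [← overlap_regroup] at h1 hK hεK
  rw [← genOverlap_regroup] at h2
  have h3 := mul_conjTranspose_mem_epsBall hε hK hεK h1 h2
  refine le_trans ?_ (le_iSup₂_of_le (f := fun τ _ => minEntropy τ) _ h3 le_rfl)
  refine minEntropy_le_of_le_conj hV.transpose (le_of_eq ?_)
  rw [regroup_mul, conjTranspose_mul]
  simp only [Matrix.mul_assoc]

/-- Every state of the ball around `ρ_AC` is dominated in min-entropy by the marginal of a pure
state on `A ⊗ B ⊗ C` close to the given one. -/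
theorem exists_minEntropy_le_regroup {ε : ℝ} (hε : 0 ≤ ε) {K : Matrix (A × B) C ℂ}
    (hK : overlap K K ≤ 1) (hεK : ε < Real.sqrt (overlap K K)) {τ : Matrix (A × C) (A × C) ℂ}
    (hτ : τ ∈ epsBall ε (regroup K * (regroup K)ᴴ)) :
    ∃ φ : Matrix (A × C) B ℂ, overlap φ φ ≤ 1 ∧ Real.sqrt (1 - ε ^ 2) ≤ genOverlap (regroup K) φ ∧
      minEntropy τ ≤ minEntropy (φ * φᴴ) := by
  have : Nonempty C := nonempty_of_overlap_pos (Real.sqrt_pos.1 (hε.trans_lt hεK))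
  rw [← overlap_regroup] at hK hεK
  obtain ⟨-, hL⟩ := sqrt_conjTranspose_and_mul hτ.1.1
  set L := CFC.sqrt τ
  rw [← hL] at hτ
  obtain ⟨V, hV, h1, h2⟩ := exists_genOverlap_of_mem_epsBall hε hK hεK hτ
  refine ⟨L * V, h1, h2, ?_⟩
  rw [← hL]
  exact minEntropy_anti (mul_mul_conjTranspose_le hV L)

/-- The smooth min-entropy of the complementary marginal depends only on the purified operator. -/
theorem smoothMinEntropy_regroup_le {D : Type*} [Fintype D] [DecidableEq D] {ε : ℝ}
    (hε : 0 ≤ ε) {K : Matrix (A × B) D ℂ} {L : Matrix (A × B) C ℂ} (hKL : K * Kᴴ = L * Lᴴ)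
    (hK : overlap K K ≤ 1) (hεK : ε < Real.sqrt (overlap K K)) :
    smoothMinEntropy ε (regroup L * (regroup L)ᴴ) ≤
      smoothMinEntropy ε (regroup K * (regroup K)ᴴ) := by
  refine iSup₂_le fun τ hτ => ?_
  have e : overlap L L = overlap K K := by rw [overlap_self, overlap_self, hKL]
  obtain ⟨φ, h1, h2, h3⟩ := exists_minEntropy_le_regroup hε (by rwa [e]) (by rwa [e]) hτ
  refine h3.trans (minEntropy_regroup_le_smoothMinEntropy (L := regroup φ) hε hK hεK ?_)
  rw [hKL]
  rw [← overlap_regroup] at h1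
  rw [← genOverlap_regroup] at h2
  exact mul_conjTranspose_mem_epsBall hε (by rwa [e]) (by rwa [e]) h1 h2

theorem smoothMaxEntropy_eq {ε : ℝ} (hε : 0 ≤ ε) {L : Matrix (A × B) C ℂ} (hL : overlap L L ≤ 1)
    (hεL : ε < Real.sqrt (overlap L L)) :
    smoothMaxEntropy ε (L * Lᴴ) = -smoothMinEntropy ε (regroup L * (regroup L)ᴴ) := by
  obtain ⟨-, h⟩ := sqrt_conjTranspose_and_mul (posSemidef_self_mul_conjTranspose L)
  have e : overlap L L = overlap (CFC.sqrt (L * Lᴴ)) (CFC.sqrt (L * Lᴴ)) := by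
    rw [overlap_self, overlap_self, h]
  rw [smoothMaxEntropy, stdPurification, marginalAC_vecMulVec]
  congr 1
  exact le_antisymm (smoothMinEntropy_regroup_le hε h.symm hL hεL)
    (smoothMinEntropy_regroup_le hε h (e.symm.trans_le hL)
      (hεL.trans_eq (congrArg Real.sqrt e)))

/-- If the generalized fidelity is one, equality in `2 Re ⟨ψ, φ⟩ ≤ ‖ψ‖² + ‖φ‖²` forces the two
vectors to be equal. -/
theorem eq_of_one_le_genOverlap {n m : Type*} [Fintype n] [Fintype m] {K L : Matrix n m ℂ}
    (hK : overlap K K ≤ 1) (hL : overlap L L ≤ 1) (h : 1 ≤ genOverlap K L) : K = L := by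
  have h1 : Real.sqrt ((1 - overlap K K) * (1 - overlap L L)) ≤
      ((1 - overlap K K) + (1 - overlap L L)) / 2 := by
    rw [Real.sqrt_le_left (by linarith)]
    nlinarith [sq_nonneg (overlap K K - overlap L L)]
  have h2 := overlap_sub_self K L
  have h3 := overlap_self_nonneg (K - L)
  unfold genOverlap at h
  have h4 : overlap (K - L) (K - L) = 0 := by linarith
  rw [overlap_self_eq_sum, Fintype.sum_eq_zero_iff_of_nonneg (fun i => by positivity)] at h4
  ext i j
  have h5 := congrFun h4 i
  simp only [Pi.zero_apply] at h5
  rw [Fintype.sum_eq_zero_iff_of_nonneg (fun i => by positivity)] at h5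
  have h6 := congrFun h5 j
  simpa [sub_eq_zero] using h6

theorem smoothMinEntropy_zero {ρ : Matrix (A × C) (A × C) ℂ} (hρ : IsSubnormalized ρ) :
    smoothMinEntropy 0 ρ = minEntropy ρ := by
  have hpos := Real.sqrt_pos.2 hρ.2.1
  obtain ⟨-, hK⟩ := sqrt_conjTranspose_and_mul hρ.1
  set K := CFC.sqrt ρ
  have hK1 : overlap K K ≤ 1 := by rw [overlap_self, hK]; exact hρ.2.2
  have hK0 : 0 < Real.sqrt (overlap K K) := by rwa [overlap_self, hK]
  have : Nonempty C := (nonempty_of_overlap_pos (Real.sqrt_pos.1 hK0)).map Prod.snd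
  apply le_antisymm
  · refine iSup₂_le fun τ hτ => ?_
    obtain ⟨-, hL⟩ := sqrt_conjTranspose_and_mul hτ.1.1
    set L := CFC.sqrt τ
    rw [← hK, ← hL] at hτ
    obtain ⟨V, hV, h1, h2⟩ := exists_genOverlap_of_mem_epsBall le_rfl hK1 hK0 hτ
    have h3 := eq_of_one_le_genOverlap hK1 h1 (by simpa using h2)
    apply minEntropy_anti
    rw [← hK, h3, ← hL]
    exact mul_mul_conjTranspose_le hV L
  · refine le_iSup₂_of_le (f := fun τ _ => minEntropy τ) ρ ?_ le_rfl
    have := mul_conjTranspose_mem_epsBall le_rfl hK1 hK0 hK1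
      (by rw [genOverlap_self hK1]; simp)
    rwa [hK] at this

theorem maxEntropy_eq {L : Matrix (A × B) C ℂ} (hL : overlap L L ≤ 1) (hL0 : 0 < overlap L L) :
    maxEntropy (L * Lᴴ) = -minEntropy (regroup L * (regroup L)ᴴ) := by
  rw [maxEntropy, smoothMaxEntropy_eq le_rfl hL (Real.sqrt_pos.2 hL0), smoothMinEntropy_zero]
  rw [← overlap_regroup, overlap_self] at hL hL0
  exact ⟨posSemidef_self_mul_conjTranspose _, hL0, hL⟩

end Duality

end SmoothEntropy

theorem mainTheorem1 {A : Type u} {B : Type v}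
    [Fintype A] [DecidableEq A] [Fintype B] [DecidableEq B]
    (ε : ℝ) (hε : 0 ≤ ε)
    (ρ : Matrix (A × B) (A × B) ℂ) (hρ : IsSubnormalized ρ)
    (hερ : ε < Real.sqrt ρ.trace.re) :
    (∀ (C : Type w) [Fintype C] [DecidableEq C]
        (ω : Matrix ((A × B) × C) ((A × B) × C) ℂ), IsPurification ρ ω →
        smoothMaxEntropy ε ρ = -smoothMinEntropy ε (marginalAC ω)) ∧
      IsLeast (maxEntropy '' epsBall ε ρ) (smoothMaxEntropy ε ρ) := by
  constructor
  · rintro C _ _ ω ⟨⟨ψ, rfl⟩, hω⟩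
    rw [traceRight_vecMulVec] at hω
    rw [marginalAC_vecMulVec, ← hω]
    apply smoothMaxEntropy_eq hε
    · rw [overlap_self, hω]; exact hρ.2.2
    · rwa [overlap_self, hω]
  · obtain ⟨-, hK⟩ := sqrt_conjTranspose_and_mul hρ.1
    set K := CFC.sqrt ρ
    have hK1 : overlap K K ≤ 1 := by rw [overlap_self, hK]; exact hρ.2.2
    have hεK : ε < Real.sqrt (overlap K K) := by rwa [overlap_self, hK]
    have hmax := smoothMaxEntropy_eq hε hK1 hεK
    have lower : ∀ τ ∈ epsBall ε ρ, smoothMaxEntropy ε ρ ≤ maxEntropy τ := by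
      intro τ hτ
      obtain ⟨-, hL⟩ := sqrt_conjTranspose_and_mul hτ.1.1
      set L := CFC.sqrt τ
      have h2 := hτ.1.2
      rw [← hL, ← overlap_self] at h2
      rw [← hK, ← hL] at hτ
      rw [← hK, ← hL, maxEntropy_eq h2.2 h2.1, hmax, EReal.neg_le_neg_iff]
      exact minEntropy_regroup_le_smoothMinEntropy hε hK1 hεK hτ
    have hK1' := hK1
    have hεK' := hεK
    rw [← overlap_regroup] at hK1' hεK'
    obtain ⟨L, h1, h2, h3⟩ := exists_forall_minEntropy_le (c := Real.sqrt (1 - ε ^ 2)) hK1'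
      (Real.sqrt_le_one.2 (by nlinarith)) fun L h1 h2 => by
        rw [overlap_self]
        exact (mul_conjTranspose_mem_epsBall hε hK1' hεK' h1 h2).1.2.1
    -- `regroup L`, as a matrix from `C` to `A ⊗ B`, purifies the state attaining the minimum.
    have h4 := (mul_conjTranspose_mem_epsBall hε hK1' hεK' h1 h2).1.2.1
    rw [← overlap_self, ← overlap_regroup] at h4
    have h1' := h1
    have h2' := h2
    rw [← overlap_regroup] at h1'
    rw [← genOverlap_regroup] at h2'
    have hmem := mul_conjTranspose_mem_epsBall hε hK1 hεK h1' h2'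
    rw [hK] at hmem
    refine ⟨⟨_, hmem, le_antisymm ?_ (lower _ hmem)⟩, ?_⟩
    · rw [maxEntropy_eq h1' h4, ← hK, hmax, EReal.neg_le_neg_iff]
      refine iSup₂_le fun τ hτ => ?_
      obtain ⟨φ, f1, f2, f3⟩ := exists_minEntropy_le_regroup hε hK1 hεK hτ
      exact f3.trans (h3 φ f1 f2)
    · rintro _ ⟨τ, hτ, rfl⟩
      exact lower τ hτ
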